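/- Proposition. For a finite ranked poset $P$ with element set $\{1,\dots,n\}$ (minimal elements have height $0$, and the height increases by $1$ along covering relations), say that $r:P\to\{1,2,3,\dots\}$ satisfies the order condition if $r(x)\le r(y)$ whenever $x\le_P y$, and $r(x)<r(y)$ whenever $x<_P y$ and $x$ has odd height. Put $$\mathbf F_P(a_1,a_2,\dots)=\sum_r a_{r(1)}a_{r(2)}\cdots a_{r(n)},\qquad F_P(x_1,x_2,\dots)=\sum_r x_{r(1)}x_{r(2)}\cdots x_{r(n)},$$ where both sums run over all $r$ satisfying the order condition, the $a_i$ are noncommuting variables and the $x_i$ commuting variables. For a set composition (ordered set partition into nonempty parts) $K=(K_0,\dots,K_{\ell-1})$ of $\{1,\dots,n\}$, let $P_K$ be the ranked poset on $\{1,\dots,n\}$ whose set of covering relations is $(K_0\times K_1)\sqcup(K_1\times K_2)\sqcup\dots\sqcup(K_{\ell-2}\times K_{\ell-1})$, so that the elements of $K_i$ have height $i$. Let $\mathbf{WQSym}$ be the $\mathbb Z$-module of word quasi-symmetric functions with integer coefficients, i.e. the $\mathbb Z$-span of the series $\mathbf M_u=\sum_{\mathrm{pack}(w)=u} a_w$,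 $u$ a packed word, where $a_w=a_{w_1}\cdots a_{w_n}$ for a word $w=w_1\cdots w_n$ of positive integers, $\mathrm{pack}(w)$ is obtained from $w$ by replacing its distinct letters $c_1<\dots<c_k$ by $1,\dots,k$, and a word is packed if its letters form an initial interval $\{1,\dots,k\}$. Let $\mathrm{QSym}$ be the $\mathbb Z$-span of the monomial quasi-symmetric functions $M_I=\sum_{c_1<\dots<c_k}x_{c_1}^{i_1}\cdots x_{c_k}^{i_k}$, $I=(i_1,\dots,i_k)$ a composition. (1) The functions $\mathbf F_{P_K}$, where $K$ runs over the set compositions of $\{1,\dots,n\}$ for all $n\ge 0$, form a $\mathbb Z$-basis of $\mathbf{WQSym}$. (2) This basis lifts Luoto's basis of $\mathrm{QSym}$ (in the convention above): for a composition $I=(i_1,\dots,i_k)$ of $n$ let $F_I:=F_{P_J}$, where $J$ is the set composition of $\{1,\dots,n\}$ into consecutive intervals of lengths $i_1,\dots,i_k$. Then the functions $F_I$, $I$ running over all compositions, form a $\mathbb Z$-basis of $\mathrm{QSym}$, and the commutative image ($a_i\mapsto x_i$) of $\mathbf F_{P_K}$ is $F_{(|K_0|,\dots,|K_{\ell-1}|)}$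 for every set composition $K$. -/

import Mathlib

noncomputable section

namespace WordQSym

/-- A ranked poset with element set `{1, …, n}` (modelled by `Fin n`). On a finite poset the
last two fields determine the height: minimal elements have height `0`, and the height
increases by `1` along each covering relation. -/
structure RankedPoset (n : ℕ) where
  order : PartialOrder (Fin n)
  height : Fin n → ℕ
  height_of_minimal : ∀ x, (∀ y, ¬ order.lt y x) → height x = 0
  height_of_cover : ∀ x y, order.lt x y → (∀ z, order.lt x z → ¬ order.lt z y) →
    height y = height x + 1

/-- The order condition on a map from a ranked poset to the positive integers:
non-decreasing, and strictly increasing above elements of odd height. -/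
def RankedPoset.OrderCondition {n : ℕ} (P : RankedPoset n) (r : Fin n → ℕ+) : Prop :=
  (∀ x y, P.order.le x y → r x ≤ r y) ∧
    (∀ x y, P.order.lt x y → Odd (P.height x) → r x < r y)

/-- Formal series with integer coefficients in the noncommuting letters `a₁, a₂, …`,
given by the coefficient of each word (a word is the list of the indices of its letters). -/
abbrev NCSeries : Type := List ℕ+ → ℤ

/-- `∑ a_{r(1)} ⋯ a_{r(n)}` over the maps `r` satisfying the order condition: the coefficient
of a word `w` is the number of such `r` with `r(1) ⋯ r(n) = w`. -/
def RankedPoset.ncF {n : ℕ} (P : RankedPoset n) : NCSeries := fun w =>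
  (({r : Fin n → ℕ+ | P.OrderCondition r ∧ List.ofFn r = w}.ncard : ℕ) : ℤ)

/-- `∑ x_{r(1)} ⋯ x_{r(n)}`, in commuting variables, over the maps `r` satisfying the
order condition. -/
def RankedPoset.F {n : ℕ} (P : RankedPoset n) : MvPowerSeries ℕ+ ℤ := fun m =>
  (({r : Fin n → ℕ+ | P.OrderCondition r ∧ ∑ i, Finsupp.single (r i) 1 = m}.ncard : ℕ) : ℤ)

/-- The packing of a word: its distinct letters `c₁ < c₂ < ⋯ < c_k` are replaced by
`1, 2, …, k`. -/
def pack (w : List ℕ+) : List ℕ+ :=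
  w.map fun a => Nat.succPNat (w.toFinset.filter (· < a)).card

/-- A word is packed if its letters form an initial interval `{1, …, k}`. -/
def IsPacked (u : List ℕ+) : Prop := ∀ a ∈ u, ∀ b ≤ a, b ∈ u

/-- The sum of all words with packing `u`. -/
def ncM (u : List ℕ+) : NCSeries := fun w => if pack w = u then 1 else 0

/-- Word quasi-symmetric functions with integer coefficients. -/
def WQSym : Submodule ℤ NCSeries := Submodule.span ℤ (ncM '' {u | IsPacked u})

/-- Monomial quasi-symmetric function:
`M_I = ∑_{a₁ < ⋯ < a_k} x_{a₁}^{i₁} ⋯ x_{a_k}^{i_k}`. -/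
def M {n : ℕ} (I : Composition n) : MvPowerSeries ℕ+ ℤ := fun m =>
  (({a : Fin I.length → ℕ+ | StrictMono a ∧
    ∑ k, Finsupp.single (a k) (I.blocksFun k) = m}.ncard : ℕ) : ℤ)

/-- Quasi-symmetric functions with integer coefficients. -/
def QSym : Submodule ℤ (MvPowerSeries ℕ+ ℤ) :=
  Submodule.span ℤ (Set.range fun I : (Σ n, Composition n) => M I.2)

/-- Commutative image `a_i ↦ x_i`: the coefficient of a monomial is the sum of the coefficients
of the (finitely many) words that are rearrangements of this monomial. -/
def commImage (f : NCSeries) : MvPowerSeries ℕ+ ℤ := fun m =>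
  ∑ w ∈ (Finsupp.toMultiset m).lists.toFinset, f w

/-- A set composition `(K_0, …, K_{ℓ-1})` of `{1, …, n}`. -/
structure SetComposition (n : ℕ) where
  length : ℕ
  part : Fin length → Finset (Fin n)
  nonempty : ∀ i, (part i).Nonempty
  disjoint : ∀ i j, i ≠ j → Disjoint (part i) (part j)
  cover : ∀ x, ∃ i, x ∈ part i

namespace SetComposition

variable {n : ℕ} (K : SetComposition n)

/-- The index `i` of the part `K_i` that contains `x`. -/
def index (x : Fin n) : Fin K.length := (K.cover x).choose

theorem mem_index (x : Fin n) : x ∈ K.part (K.index x) := (K.cover x).choose_spec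

theorem index_eq {x : Fin n} {i : Fin K.length} (h : x ∈ K.part i) : K.index x = i := by
  by_contra hne
  exact Finset.disjoint_left.mp (K.disjoint _ _ hne) (K.mem_index x) h

/-- The relation `(K_0 × K_1) ⊔ (K_1 × K_2) ⊔ ⋯`. -/
def Rel (x y : Fin n) : Prop :=
  ∃ i j : Fin K.length, (j : ℕ) = i + 1 ∧ x ∈ K.part i ∧ y ∈ K.part j

theorem Rel.index_succ {K : SetComposition n} {x y : Fin n} (h : K.Rel x y) :
    (K.index y : ℕ) = K.index x + 1 := by
  obtain ⟨i, j, hij, hx, hy⟩ := h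
  rw [K.index_eq hx, K.index_eq hy, hij]

theorem eq_or_index_lt {x y : Fin n} (h : Relation.ReflTransGen K.Rel x y) :
    x = y ∨ (K.index x : ℕ) < K.index y := by
  induction h with
  | refl => exact Or.inl rfl
  | tail _ hbc ih =>
    have := hbc.index_succ
    rcases ih with rfl | ih <;> right <;> omega

/-- The partial order generated by `Rel`. -/
@[reducible]
def order : PartialOrder (Fin n) where
  le := Relation.ReflTransGen K.Rel
  lt x y := Relation.ReflTransGen K.Rel x y ∧ ¬ Relation.ReflTransGen K.Rel y x
  le_refl _ := Relation.ReflTransGen.refl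
  le_trans _ _ _ := Relation.ReflTransGen.trans
  lt_iff_le_not_ge _ _ := Iff.rfl
  le_antisymm x y hxy hyx := by
    rcases K.eq_or_index_lt hxy with h | h
    · exact h
    · rcases K.eq_or_index_lt hyx with h' | h'
      · exact h'.symm
      · omega

theorem lt_of_rel {x y : Fin n} (h : K.Rel x y) : K.order.lt x y := by
  refine ⟨Relation.ReflTransGen.single h, fun h' => ?_⟩
  have := h.index_succ
  rcases K.eq_or_index_lt h' with rfl | h' <;> omega

/-- The layered ranked poset `P_K`; elements of `K_i` have height `i`. -/
def poset : RankedPoset n where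
  order := K.order
  height x := K.index x
  height_of_minimal x hx := by
    by_contra hne
    have hlt : (K.index x : ℕ) - 1 < K.length := by have := (K.index x).isLt; omega
    obtain ⟨y, hy⟩ := K.nonempty ⟨(K.index x : ℕ) - 1, hlt⟩
    refine hx y (K.lt_of_rel ⟨_, K.index x, ?_, hy, K.mem_index x⟩)
    simp only
    omega
  height_of_cover x y hxy hcov := by
    rcases Relation.ReflTransGen.cases_head hxy.1 with h | ⟨z, hxz, hzy⟩
    · subst h
      exact absurd hxy.1 hxy.2
    · have hz : z = y := by
        rcases K.eq_or_index_lt hzy with h | h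
        · exact h
        · refine absurd ⟨hzy, fun h' => ?_⟩ (hcov z (K.lt_of_rel hxz))
          rcases K.eq_or_index_lt h' with rfl | h' <;> omega
      subst hz
      exact hxz.index_succ

/-- The composition `(|K_0|, …, |K_{ℓ-1}|)` of `n`. -/
def type : Composition n where
  blocks := List.ofFn fun i => (K.part i).card
  blocks_pos := by
    intro k hk
    obtain ⟨i, rfl⟩ := (List.mem_ofFn' _ _).mp hk
    exact (K.nonempty i).card_pos
  blocks_sum := by
    rw [List.sum_ofFn, ← Finset.card_biUnion fun i _ j _ h => K.disjoint i j h]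
    have : (Finset.univ.biUnion K.part) = Finset.univ := by
      ext x
      simpa using K.cover x
    rw [this, Finset.card_univ, Fintype.card_fin]

/-- The set composition of `{1, …, n}` whose parts are consecutive intervals of lengths
`i_1, …, i_k`, for a composition `(i_1, …, i_k)` of `n`. -/
def ofComposition (I : Composition n) : SetComposition n where
  length := I.length
  part k := Finset.univ.filter fun x => I.index x = k
  nonempty k := ⟨I.embedding k ⟨0, I.one_le_blocksFun k⟩, by simp⟩
  disjoint i j h := Finset.disjoint_left.mpr fun x hi hj => h (by simp_all)
  cover x := ⟨I.index x, by simp⟩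

end SetComposition

/-- The commutative function `F_{P_I}` of the layered ranked poset with `i_1, i_2, …`
elements in its successive layers. -/
def layeredF {n : ℕ} (I : Composition n) : MvPowerSeries ℕ+ ℤ :=
  (SetComposition.ofComposition I).poset.F

end WordQSym

end

/-!
The coefficient of a word in `F_{P_K}` is the indicator of a condition on the map `r` sending a
position to its letter, so everything takes place among functions of `r`, where a word monomial
function is the indicator of the maps ordering the positions as a given packed word does.

In each degree `n` the functions `F_{P_K}` and the word monomial functions are indexed by the same
finite set, the set compositions of `{1, …, n}`. Since the latter are linearly independent, it is
enough to show that the `F_{P_K}` span them over `ℤ`: a generating family of `d` elements in a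
free `ℤ`-module of rank `d` is a basis (`linearIndependent_of_graded_span`).

The spanning statement is `samePattern_mem_layerSpan`, proved for all finite sets `R` of positions
by induction on `R`. Putting two nonempty layers `X`, `Y` at the bottom multiplies the function of
a layered poset on `T` by the indicator of `X ≤ Y < T` (`mul_mem_layerSpan`), and by induction the
word monomial functions on `T = R \ (X ∪ Y)` are already available. Hence the product of such an
indicator with a word monomial function on `T` lies in the span. Sort the maps counted by the
indicator of `X ≤ Y` by the set where they attain their maximum on `S = X ∪ Y`
(`ind_weakBelow_eq`): when this set is a proper subset of `Y`, the term is of the same form with a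
smaller `Y`. What remains is the relation `∑_{C ⊆ X} m(C) ≡ 0` for every nonempty proper `X ⊂ S`,
where `m(C)` stands for `r` being constant on `S \ C` and larger there than on `C`, up to the
common factor formed by `S < T` and the pattern on `T` (`sum_isTop_mem`). Inverting these
relations gives `m(C) ≡ (-1)^|C| m(∅)` for every proper subset `C` (`isTop_sub_mem`). On the other
hand, the sum of `m(C)` over all proper subsets `C` is the common factor alone, so that `m(∅)`,
the term of the maps constant on `S`, lies in the span as soon as this factor does
(`constOn_mem_of_below_mem`). For `T = ∅` the factor is `1`, the function of an antichain; for `T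
≠ ∅` the unrestricted bottom set `S` is, up to sign, equivalent to a constant block consisting of
`S` and the lowest block of the pattern on `T`, and an induction on `T` completes the proof
(`constOn_below_samePattern_mem`).

The commutative image only depends on the sizes of the layers, and maps the word monomial
functions onto the monomial quasi-symmetric functions. The spanning statement for `QSym` is
therefore the image of the one for `WQSym`, and the same rank argument gives the basis.
-/

noncomputable section

namespace WordQSym

/-! ### Indicator functions -/

open Classical in
/-- The `ℤ`-valued indicator function of a predicate. -/
def ind {Ω : Type*} (p : Ω → Prop) : Ω → ℤ := fun r => if p r then 1 else 0

theorem ind_mul {Ω : Type*} (p q : Ω → Prop) : ind p * ind q = ind fun r => p r ∧ q r := by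
  ext r
  by_cases hp : p r <;> by_cases hq : q r <;> simp [ind, hp, hq]

theorem ind_congr {Ω : Type*} {p q : Ω → Prop} (h : ∀ r, p r ↔ q r) : ind p = ind q := by
  obtain rfl : p = q := funext fun r => propext (h r)
  rfl

theorem ind_eq_one {Ω : Type*} {p : Ω → Prop} (h : ∀ r, p r) : ind p = 1 := by
  ext r
  simp [ind, h r]

/-! ### Patterns and layered posets on a finite set of positions -/

section Patterns

variable {α β : Type*} [LinearOrder β]

/-- Every value of `r` on `X` is smaller than every value of `r` on `Y`. -/
def Below (X Y : Finset α) (r : α → β) : Prop := ∀ x ∈ X, ∀ y ∈ Y, r x < r y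

/-- Every value of `r` on `X` is at most every value of `r` on `Y`. -/
def WeakBelow (X Y : Finset α) (r : α → β) : Prop := ∀ x ∈ X, ∀ y ∈ Y, r x ≤ r y

/-- `r` is constant on `X`. -/
def ConstOn (X : Finset α) (r : α → β) : Prop := ∀ x ∈ X, ∀ y ∈ X, r x = r y

/-- On `S`, the map `r` takes its values in the same relative order as `u`. The indicator functions
of these predicates are the word monomial functions, for words indexed by `S`. -/
def SamePattern (S : Finset α) (u : α → ℕ) (r : α → β) : Prop :=
  ∀ x ∈ S, ∀ y ∈ S, r x < r y ↔ u x < u y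

/-- `k` cuts `S` into successive nonempty layers, the `i`-th one being `{x ∈ S | k x = i}`. This
encodes a set composition of `S`. -/
def IsLayering (S : Finset α) (k : α → ℕ) : Prop := ∀ x ∈ S, ∀ j < k x, ∃ y ∈ S, k y = j

/-- The order condition for the layered poset on `S` whose heights are given by `k`. -/
def LayerCond (S : Finset α) (k : α → ℕ) (r : α → β) : Prop :=
  ∀ x ∈ S, ∀ y ∈ S, k x < k y → r x ≤ r y ∧ (Odd (k x) → r x < r y)

variable (β) in
/-- The span of the generating functions of all layered posets on `S`. -/
def layerSpan (S : Finset α) : Submodule ℤ ((α → β) → ℤ) :=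
  Submodule.span ℤ {f | ∃ k, IsLayering S k ∧ f = ind (LayerCond S k)}

/-- The antichain on `S` has the constant generating function `1`. -/
theorem one_mem_layerSpan (S : Finset α) : (1 : (α → β) → ℤ) ∈ layerSpan β S := by
  refine Submodule.subset_span ⟨fun _ => 0, fun x _ j hj => absurd hj (Nat.not_lt_zero j), ?_⟩
  refine (ind_eq_one fun r x _ y _ h => absurd h (lt_irrefl _)).symm

/-- The set where `r` attains its maximum on `S`. -/
def topSet (S : Finset α) (r : α → β) : Finset α := S.filter fun x => ∀ y ∈ S, r y ≤ r x

theorem topSet_subset (S : Finset α) (r : α → β) : topSet S r ⊆ S := Finset.filter_subset _ _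

theorem topSet_nonempty {S : Finset α} (hS : S.Nonempty) (r : α → β) : (topSet S r).Nonempty := by
  obtain ⟨x, hx, h⟩ := S.exists_max_image r hS
  exact ⟨x, Finset.mem_filter.mpr ⟨hx, h⟩⟩

variable [DecidableEq α]

/-- Two new bottom layers `X` and `Y` keep the parity of the other heights, so placing them under
the layered posets on `T` multiplies the generating functions by an indicator function. -/
theorem mul_mem_layerSpan {X Y T : Finset α} (hX : X.Nonempty) (hY : Y.Nonempty)
    (hXY : Disjoint X Y) (hXT : Disjoint X T) (hYT : Disjoint Y T) {φ : (α → β) → ℤ}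
    (hφ : φ ∈ layerSpan β T) :
    ind (WeakBelow X Y) * ind (Below (X ∪ Y) T) * φ ∈ layerSpan β (X ∪ Y ∪ T) := by
  induction hφ using Submodule.span_induction with
  | zero => simp
  | add f g _ _ hf hg => rw [mul_add]; exact add_mem hf hg
  | smul a f _ hf => rw [mul_smul_comm]; exact Submodule.smul_mem _ _ hf
  | mem f hf =>
    obtain ⟨k, hk, rfl⟩ := hf
    set k' : α → ℕ := fun x => if x ∈ X then 0 else if x ∈ Y then 1 else k x + 2 with hk'
    have kX : ∀ x ∈ X, k' x = 0 := fun x hx => by simp [hk', hx]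
    have kY : ∀ x ∈ Y, k' x = 1 := fun x hx => by
      simp [hk', hx, Finset.disjoint_right.mp hXY hx]
    have kT : ∀ x ∈ T, k' x = k x + 2 := fun x hx => by
      simp [hk', Finset.disjoint_right.mp hXT hx, Finset.disjoint_right.mp hYT hx]
    refine Submodule.subset_span ⟨k', ?_, ?_⟩
    · intro x hx j hj
      obtain ⟨x₀, hx₀⟩ := hX
      obtain ⟨y₀, hy₀⟩ := hY
      rcases j with _ | _ | j
      · exact ⟨x₀, by simp [hx₀], kX x₀ hx₀⟩
      · exact ⟨y₀, by simp [hy₀], kY y₀ hy₀⟩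
      · simp only [Finset.mem_union] at hx
        rcases hx with (hx | hx) | hx
        · rw [kX x hx] at hj; omega
        · rw [kY x hx] at hj; omega
        · rw [kT x hx] at hj
          obtain ⟨y, hy, rfl⟩ := hk x hx j (by omega)
          exact ⟨y, by simp [hy], kT y hy⟩
    · rw [ind_mul, ind_mul]
      refine ind_congr fun r => ⟨?_, ?_⟩
      · rintro ⟨⟨h1, h2⟩, h3⟩ x hx y hy hxy
        simp only [Finset.mem_union] at hx hy
        have key : ∀ z ∈ X ∪ Y, y ∈ T → r z ≤ r y ∧ (Odd (k' z) → r z < r y) :=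
          fun z hz hy => ⟨(h2 z hz y hy).le, fun _ => h2 z hz y hy⟩
        rcases hx with (hx | hx) | hx <;> rcases hy with (hy | hy) | hy
        · rw [kX x hx, kX y hy] at hxy; omega
        · exact ⟨h1 x hx y hy, fun h => by rw [kX x hx] at h; simp at h⟩
        · exact key x (by simp [hx]) hy
        · rw [kY x hx, kX y hy] at hxy; omega
        · rw [kY x hx, kY y hy] at hxy; omega
        · exact key x (by simp [hx]) hy
        · rw [kT x hx, kX y hy] at hxy; omega
        · rw [kT x hx, kY y hy] at hxy; omega
        · rw [kT x hx, kT y hy] at hxy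
          refine ⟨(h3 x hx y hy (by omega)).1, fun h => (h3 x hx y hy (by omega)).2 ?_⟩
          rw [kT x hx] at h
          simpa [Nat.odd_add] using h
      · intro h
        have h1 : WeakBelow X Y r := fun x hx y hy =>
          (h x (by simp [hx]) y (by simp [hy]) (by rw [kX x hx, kY y hy]; omega)).1
        have h2 : Below Y T r := fun x hx y hy =>
          (h x (by simp [hx]) y (by simp [hy]) (by rw [kY x hx, kT y hy]; omega)).2
            (by rw [kY x hx]; exact odd_one)
        refine ⟨⟨h1, ?_⟩, ?_⟩
        · intro x hx t ht
          rcases Finset.mem_union.mp hx with hx | hx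
          · obtain ⟨y, hy⟩ := hY
            exact (h1 x hx y hy).trans_lt (h2 y hy t ht)
          · exact h2 x hx t ht
        · intro x hx y hy hxy
          have := h x (by simp [hx]) y (by simp [hy]) (by rw [kT x hx, kT y hy]; omega)
          refine ⟨this.1, fun hodd => this.2 ?_⟩
          rw [kT x hx]
          simpa [Nat.odd_add] using hodd

/-- For a nonempty `Z ⊆ S`: the maximum of `r` on `S` is attained exactly on `Z`. -/
def IsTop (S Z : Finset α) (r : α → β) : Prop := Below (S \ Z) Z r ∧ ConstOn Z r

theorem isTop_iff {S Z : Finset α} (hZ : Z.Nonempty) (hZS : Z ⊆ S) (r : α → β) :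
    IsTop S Z r ↔ Z = topSet S r := by
  constructor
  · rintro ⟨h1, h2⟩
    ext x
    simp only [topSet, Finset.mem_filter]
    constructor
    · intro hx
      refine ⟨hZS hx, fun y hy => ?_⟩
      by_cases hyZ : y ∈ Z
      · exact (h2 y hyZ x hx).le
      · exact (h1 y (by simp [hy, hyZ]) x hx).le
    · rintro ⟨hxS, hx⟩
      by_contra hxZ
      obtain ⟨z, hz⟩ := hZ
      exact absurd (h1 x (by simp [hxS, hxZ]) z hz) (hx z (hZS hz)).not_gt
  · rintro rfl
    simp only [IsTop, Below, ConstOn, topSet, Finset.mem_sdiff, Finset.mem_filter]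
    refine ⟨fun x hx y hy => lt_of_le_of_ne (hy.2 x hx.1) fun h => hx.2 ⟨hx.1, ?_⟩,
      fun x hx y hy => le_antisymm (hy.2 x hx.1) (hx.2 y hy.1)⟩
    rw [h]
    exact hy.2

theorem ind_isTop_apply {S Z : Finset α} (hZ : Z.Nonempty) (hZS : Z ⊆ S) (r : α → β) :
    ind (IsTop S Z) r = if Z = topSet S r then 1 else 0 := by
  simp [ind, isTop_iff hZ hZS r]

/-- The maximum of `r` on `S` is attained on exactly one complement `S \ C`, so the sum only records
whether the corresponding `C` belongs to `A`. -/
theorem sum_ind_isTop_apply {S : Finset α} (A : Finset (Finset α))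
    (hA : ∀ C ∈ A, C ⊂ S) (r : α → β) :
    ∑ C ∈ A, ind (IsTop S (S \ C)) r = if S \ topSet S r ∈ A then 1 else 0 := by
  rw [← Finset.sum_ite_eq' A (S \ topSet S r) fun _ => (1 : ℤ)]
  refine Finset.sum_congr rfl fun C hC => ?_
  have hCS := hA C hC
  rw [ind_isTop_apply (Finset.sdiff_nonempty.mpr hCS.2) Finset.sdiff_subset]
  congr 1
  refine propext ⟨fun h => ?_, fun h => ?_⟩
  · rw [← h, Finset.sdiff_sdiff_eq_self hCS.1]
  · rw [h, Finset.sdiff_sdiff_eq_self (topSet_subset S r)]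

/-- Sorting the maps `r` by the set where they attain their maximum on `S`: it is either a proper
part of `S \ X`, or all of `S \ X` together with some elements of `X`. -/
theorem ind_weakBelow_eq {S X : Finset α} (hX : X.Nonempty) (hXS : X ⊂ S) :
    (ind (WeakBelow X (S \ X)) : (α → β) → ℤ) =
      ∑ C ∈ X.powerset, ind (IsTop S (S \ C)) +
        ∑ Z ∈ (S \ X).ssubsets.erase ∅, ind (WeakBelow X ((S \ X) \ Z)) * ind (IsTop S Z) := by
  have hS : S.Nonempty := hX.mono hXS.1
  ext r
  simp only [Pi.add_apply, Finset.sum_apply, Pi.mul_apply]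
  rw [sum_ind_isTop_apply X.powerset
    fun C hC => lt_of_le_of_lt (Finset.mem_powerset.mp hC) hXS]
  have h2 : ∑ Z ∈ (S \ X).ssubsets.erase ∅,
      ind (WeakBelow X ((S \ X) \ Z)) r * ind (IsTop S Z) r =
      if topSet S r ∈ (S \ X).ssubsets.erase ∅ then ind (WeakBelow X ((S \ X) \ topSet S r)) r
        else 0 := by
    rw [← Finset.sum_ite_eq' _ (topSet S r) fun Z => ind (WeakBelow X ((S \ X) \ Z)) r]
    refine Finset.sum_congr rfl fun Z hZ => ?_
    simp only [Finset.mem_erase, Finset.mem_ssubsets] at hZ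
    rw [ind_isTop_apply (Finset.nonempty_iff_ne_empty.mpr hZ.1)
      (hZ.2.1.trans Finset.sdiff_subset)]
    simp
  rw [h2]
  have hne := topSet_nonempty hS r
  have hsub := topSet_subset S r
  have hmax : ∀ x ∈ topSet S r, ∀ y ∈ S, r y ≤ r x := fun x hx => (Finset.mem_filter.mp hx).2
  have hmax' : ∀ x ∈ topSet S r, ∀ y ∈ S, r x ≤ r y → y ∈ topSet S r := fun x hx y hy h =>
    Finset.mem_filter.mpr ⟨hy, fun z hz => (hmax x hx z hz).trans h⟩
  generalize topSet S r = Z at *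
  simp only [Finset.mem_powerset, Finset.mem_erase, Finset.mem_ssubsets, hne.ne_empty, ne_eq,
    not_false_eq_true, true_and]
  by_cases h : S \ X ⊆ Z
  · have h1 : S \ Z ⊆ X := fun x hx => by
      by_contra hxX
      simp only [Finset.mem_sdiff] at hx
      exact hx.2 (h (by simp [hx.1, hxX]))
    have h3 : ¬ Z ⊂ S \ X := fun h' => h'.2 h
    have h4 : WeakBelow X (S \ X) r := fun x hx y hy => hmax y (h hy) x (hXS.1 hx)
    simp [ind, h1, h3, h4]
  · have h1 : ¬ S \ Z ⊆ X := fun h' => h fun x hx => by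
      by_contra hxZ
      simp only [Finset.mem_sdiff] at hx
      exact hx.2 (h' (by simp [hx.1, hxZ]))
    by_cases h3 : Z ⊆ S \ X
    · have h4 : WeakBelow X (S \ X) r ↔ WeakBelow X ((S \ X) \ Z) r := by
        refine ⟨fun H x hx y hy => H x hx y (Finset.sdiff_subset hy), fun H x hx y hy => ?_⟩
        by_cases hyZ : y ∈ Z
        · exact hmax y hyZ x (hXS.1 hx)
        · exact H x hx y (by simp only [Finset.mem_sdiff] at hy ⊢; exact ⟨hy, hyZ⟩)
      have h5 : Z ⊂ S \ X := ⟨h3, h⟩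
      by_cases h6 : WeakBelow X ((S \ X) \ Z) r <;> simp [ind, h1, h4, h5, h6]
    · have h4 : ¬ WeakBelow X (S \ X) r := fun H => by
        obtain ⟨x, hxZ, hx⟩ := Finset.not_subset.mp h3
        have hxX : x ∈ X := by
          by_contra hxX
          exact hx (by simp [hsub hxZ, hxX])
        exact h fun y hy => hmax' x hxZ y (Finset.sdiff_subset hy) (H x hxX y hy)
      have h5 : ¬ Z ⊂ S \ X := fun h' => h3 h'.1
      simp [ind, h1, h4, h5]

/-! ### Cyclic relations and their inversion -/

section Reduction

variable {S T : Finset α} {φ : (α → β) → ℤ}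

/-- The cyclic relation: modulo the span of the layered posets, the terms of the decomposition by
maximum sets containing `S \ X` add up to zero. -/
theorem sum_isTop_mem (hST : Disjoint S T)
    (hφ : ∀ Z ⊂ S, ind (ConstOn Z) * ind (Below Z T) * φ ∈ layerSpan β (Z ∪ T))
    {X : Finset α} (hX : X.Nonempty) (hXS : X ⊂ S) :
    ∑ C ∈ X.powerset, ind (IsTop S (S \ C)) * (ind (Below S T) * φ) ∈ layerSpan β (S ∪ T) := by
  have hY : (S \ X).Nonempty := Finset.sdiff_nonempty.mpr hXS.2
  have hXT : Disjoint X T := Finset.disjoint_of_subset_left hXS.1 hST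
  have hYT : Disjoint (S \ X) T := Finset.disjoint_of_subset_left Finset.sdiff_subset hST
  rw [← Finset.sum_mul, ← sub_eq_of_eq_add (ind_weakBelow_eq hX hXS), sub_mul]
  refine sub_mem ?_ ?_
  · -- The case `Z = ∅` of the hypothesis says that `φ` itself lies in the span for `T`.
    have h0 := hφ ∅ ((Finset.empty_subset _).ssubset_of_ne (hX.mono hXS.1).ne_empty.symm)
    rw [ind_eq_one (p := ConstOn ∅) (by simp [ConstOn]),
      ind_eq_one (p := Below ∅ T) (by simp [Below]), one_mul, one_mul, Finset.empty_union] at h0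
    have := mul_mem_layerSpan hX hY Finset.disjoint_sdiff hXT hYT h0
    rwa [Finset.union_sdiff_of_subset hXS.1, mul_assoc] at this
  · rw [Finset.sum_mul]
    refine sum_mem fun Z hZ => ?_
    simp only [Finset.mem_erase, Finset.mem_ssubsets] at hZ
    obtain ⟨-, hZ⟩ := hZ
    have hZS : Z ⊂ S := lt_of_lt_of_le hZ Finset.sdiff_subset
    have hXZ : Disjoint X Z := (Finset.disjoint_of_subset_left hZ.1 Finset.sdiff_disjoint).symm
    have hXYZ : X ∪ (S \ X) \ Z = S \ Z := by
      ext x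
      have h1 := @hXS.1 x
      have h2 : x ∈ X → x ∉ Z := fun h => Finset.disjoint_left.mp hXZ h
      simp only [Finset.mem_union, Finset.mem_sdiff]
      tauto
    have := mul_mem_layerSpan hX (Finset.sdiff_nonempty.mpr hZ.2)
      (Finset.disjoint_of_subset_right Finset.sdiff_subset Finset.disjoint_sdiff)
      (Finset.disjoint_union_right.mpr ⟨hXZ, hXT⟩)
      (Finset.disjoint_union_right.mpr ⟨Finset.sdiff_disjoint,
        Finset.disjoint_of_subset_left Finset.sdiff_subset hYT⟩) (hφ Z hZS)
    rw [hXYZ, ← Finset.union_assoc, Finset.sdiff_union_of_subset hZS.1] at this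
    convert this using 1
    simp only [← mul_assoc]
    congr 1
    simp only [ind_mul]
    refine ind_congr fun r => ?_
    constructor
    · rintro ⟨⟨h1, h2, h3⟩, h4⟩
      refine ⟨⟨⟨h1, fun x hx y hy => ?_⟩, h3⟩, fun x hx => h4 x (hZS.1 hx)⟩
      rcases Finset.mem_union.mp hy with hy | hy
      · exact h2 x hx y hy
      · exact h4 x (Finset.sdiff_subset hx) y hy
    · rintro ⟨⟨⟨h1, h2⟩, h3⟩, h4⟩
      refine ⟨⟨h1, fun x hx y hy => h2 x hx y (Finset.mem_union_left _ hy), h3⟩,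
        fun x hx y hy => ?_⟩
      by_cases hxZ : x ∈ Z
      · exact h4 x hxZ y hy
      · exact h2 x (Finset.mem_sdiff.mpr ⟨hx, hxZ⟩) y (Finset.mem_union_right _ hy)

/-- Inversion of the cyclic relations: they make all terms equal up to sign. -/
theorem isTop_sub_mem (hST : Disjoint S T)
    (hφ : ∀ Z ⊂ S, ind (ConstOn Z) * ind (Below Z T) * φ ∈ layerSpan β (Z ∪ T))
    (X : Finset α) (hXS : X ⊂ S) :
    ind (IsTop S (S \ X)) * (ind (Below S T) * φ) -
      (-1 : ℤ) ^ X.card • (ind (IsTop S S) * (ind (Below S T) * φ)) ∈ layerSpan β (S ∪ T) := by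
  induction X using Finset.strongInduction with
  | H X ih =>
    rcases X.eq_empty_or_nonempty with rfl | hX
    · simp
    · have h1 := sum_isTop_mem hST hφ hX hXS
      have h2 : ∑ C ∈ X.powerset, (ind (IsTop S (S \ C)) * (ind (Below S T) * φ) -
          (-1 : ℤ) ^ C.card • (ind (IsTop S S) * (ind (Below S T) * φ))) ∈
            layerSpan β (S ∪ T) := by
        rwa [Finset.sum_sub_distrib, ← Finset.sum_smul,
          Finset.sum_powerset_neg_one_pow_card_of_nonempty hX, zero_smul, sub_zero]
      rw [← Finset.add_sum_erase _ _ (Finset.mem_powerset_self X)] at h2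
      refine (Submodule.add_mem_iff_left _ (sum_mem fun C hC => ?_)).mp h2
      have hC' := Finset.mem_ssubsets.mp (show C ∈ X.ssubsets from hC)
      exact ih C hC' (hC'.trans hXS)

/-- Since the signs of the proper subsets of `S` do not add up to zero, the term of the maps that
are constant on `S` can be isolated. -/
theorem constOn_mem_of_below_mem (hS : S.Nonempty) (hST : Disjoint S T)
    (hφ : ∀ Z ⊂ S, ind (ConstOn Z) * ind (Below Z T) * φ ∈ layerSpan β (Z ∪ T))
    (h : ind (Below S T) * φ ∈ layerSpan β (S ∪ T)) :
    ind (ConstOn S) * (ind (Below S T) * φ) ∈ layerSpan β (S ∪ T) := by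
  have hone : ∑ C ∈ S.ssubsets, ind (IsTop S (S \ C)) = (1 : (α → β) → ℤ) := by
    ext r
    have hm : S \ topSet S r ∈ S.ssubsets := by
      rw [Finset.mem_ssubsets]
      refine Finset.sdiff_subset.ssubset_of_ne fun h => ?_
      obtain ⟨x, hx⟩ := topSet_nonempty hS r
      have := h ▸ topSet_subset S r hx
      exact (Finset.mem_sdiff.mp this).2 hx
    rw [Finset.sum_apply, sum_ind_isTop_apply _ (fun C hC => Finset.mem_ssubsets.mp hC),
      if_pos hm, Pi.one_apply]
  have hsign : ∑ C ∈ S.ssubsets, (-1 : ℤ) ^ C.card = -(-1) ^ S.card := by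
    have := Finset.sum_powerset_neg_one_pow_card_of_nonempty hS
    rw [← Finset.add_sum_erase _ _ (Finset.mem_powerset_self S)] at this
    exact (neg_eq_of_add_eq_zero_right this).symm
  have hsum := sum_mem (t := S.ssubsets) fun C hC =>
    isTop_sub_mem hST hφ C (Finset.mem_ssubsets.mp hC)
  rw [Finset.sum_sub_distrib, ← Finset.sum_mul, hone, one_mul, ← Finset.sum_smul, hsign] at hsum
  have h3 := (Submodule.sub_mem_iff_right _ h).mp hsum
  have h4 := Submodule.smul_mem _ (-(-1 : ℤ) ^ S.card) h3
  rw [smul_smul, neg_mul_neg, ← mul_pow, neg_mul_neg, one_mul, one_pow, one_smul] at h4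
  rwa [ind_congr (q := ConstOn S) fun r => by simp [IsTop, Below]] at h4

end Reduction

/-! ### The layered posets span the word monomial functions -/

/-- A block of equal values below a pattern is a pattern. -/
theorem exists_samePattern_union (u : α → ℕ) {Z T : Finset α} (h : Disjoint Z T) :
    ∃ v, ind (ConstOn Z) * ind (Below Z T) * ind (SamePattern T u) =
      (ind (SamePattern (Z ∪ T) v) : (α → β) → ℤ) := by
  -- The shift makes room for the new lowest value `0`.
  refine ⟨fun x => if x ∈ Z then 0 else u x + 1, ?_⟩
  rw [ind_mul, ind_mul]
  refine ind_congr fun r => ?_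
  have hT : ∀ x ∈ T, x ∉ Z := fun x hx => Finset.disjoint_right.mp h hx
  constructor
  · rintro ⟨⟨h1, h2⟩, h3⟩ x hx y hy
    rcases Finset.mem_union.mp hx with hx | hx <;> rcases Finset.mem_union.mp hy with hy | hy
    · simp [hx, hy, h1 x hx y hy]
    · simp [hx, hT y hy, h2 x hx y hy]
    · simp [hy, hT x hx, (h2 y hy x hx).le]
    · simp [hT x hx, hT y hy, h3 x hx y hy]
  · intro H
    refine ⟨⟨fun x hx y hy => ?_, fun x hx y hy => ?_⟩, fun x hx y hy => ?_⟩
    · have h1 := H x (by simp [hx]) y (by simp [hy])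
      have h2 := H y (by simp [hy]) x (by simp [hx])
      simp only [hx, hy, if_true, lt_irrefl, iff_false, not_lt] at h1 h2
      exact le_antisymm h2 h1
    · have h1 := H x (by simp [hx]) y (by simp [hy])
      simpa [hx, hT y hy] using h1
    · have h1 := H x (by simp [hx]) y (by simp [hy])
      simpa [hT x hx, hT y hy] using h1

/-- A pattern on a nonempty set is a block of equal values below a pattern. -/
theorem exists_block_samePattern (u : α → ℕ) {T : Finset α} (hT : T.Nonempty) :
    ∃ Z ⊆ T, Z.Nonempty ∧ (ind (SamePattern T u) : (α → β) → ℤ) =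
      ind (ConstOn Z) * ind (Below Z (T \ Z)) * ind (SamePattern (T \ Z) u) := by
  obtain ⟨x₀, hx₀, hmin⟩ := T.exists_min_image u hT
  set Z := T.filter fun x => u x = u x₀ with hZ
  have mZ : ∀ x, x ∈ Z ↔ x ∈ T ∧ u x = u x₀ := fun x => by rw [hZ, Finset.mem_filter]
  have mTZ : ∀ x, x ∈ T \ Z ↔ x ∈ T ∧ u x₀ < u x := fun x => by
    rw [Finset.mem_sdiff, mZ]
    exact ⟨fun h => ⟨h.1, lt_of_le_of_ne (hmin x h.1) fun h' => h.2 ⟨h.1, h'.symm⟩⟩,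
      fun h => ⟨h.1, fun h' => h.2.ne' h'.2⟩⟩
  refine ⟨Z, Finset.filter_subset _ _, ⟨x₀, by simp [hZ, hx₀]⟩, ?_⟩
  rw [ind_mul, ind_mul]
  refine ind_congr fun r => ⟨fun H => ⟨⟨fun x hx y hy => ?_, fun x hx y hy => ?_⟩,
    fun x hx y hy => H x (Finset.sdiff_subset hx) y (Finset.sdiff_subset hy)⟩, ?_⟩
  · rw [mZ] at hx hy
    have h1 := H x hx.1 y hy.1
    have h2 := H y hy.1 x hx.1
    rw [hx.2, hy.2] at h1 h2
    exact le_antisymm (not_lt.mp fun h => lt_irrefl _ (h2.mp h))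
      (not_lt.mp fun h => lt_irrefl _ (h1.mp h))
  · rw [mZ] at hx
    rw [mTZ] at hy
    rw [H x hx.1 y hy.1, hx.2]
    exact hy.2
  · rintro ⟨⟨h1, h2⟩, h3⟩ x hx y hy
    by_cases hxZ : x ∈ Z <;> by_cases hyZ : y ∈ Z
    · rw [h1 x hxZ y hyZ, ((mZ x).mp hxZ).2, ((mZ y).mp hyZ).2]
      simp
    · have hy' : y ∈ T \ Z := Finset.mem_sdiff.mpr ⟨hy, hyZ⟩
      simp [h2 x hxZ y hy', ((mZ x).mp hxZ).2, ((mTZ y).mp hy').2]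
    · have hx' : x ∈ T \ Z := Finset.mem_sdiff.mpr ⟨hx, hxZ⟩
      rw [((mZ y).mp hyZ).2]
      exact iff_of_false (h2 y hyZ x hx').not_gt ((mTZ x).mp hx').2.not_gt
    · exact h3 x (Finset.mem_sdiff.mpr ⟨hx, hxZ⟩) y (Finset.mem_sdiff.mpr ⟨hy, hyZ⟩)

/-- The inductive step for `samePattern_mem_layerSpan`: the set of positions `R` is split into the
lowest block `S` of a pattern and the rest `T`. -/
theorem constOn_below_samePattern_mem (u : α → ℕ) {R : Finset α}
    (ih : ∀ R' ⊂ R, ∀ v, ind (SamePattern R' v) ∈ layerSpan β R') (T : Finset α) :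
    ∀ S : Finset α, S.Nonempty → Disjoint S T → S ∪ T = R →
      ind (ConstOn S) * (ind (Below S T) * ind (SamePattern T u)) ∈ layerSpan β R := by
  have hφ : ∀ S T : Finset α, Disjoint S T → S ∪ T = R → ∀ Z ⊂ S,
      ind (ConstOn Z) * ind (Below Z T) * ind (SamePattern T u) ∈ layerSpan β (Z ∪ T) := by
    rintro S T hST rfl Z hZ
    obtain ⟨v, hv⟩ := exists_samePattern_union (β := β) u
      (Finset.disjoint_of_subset_left hZ.1 hST)
    rw [hv]
    refine ih _ ⟨Finset.union_subset_union_left hZ.1, fun h => hZ.2 fun x hx => ?_⟩ v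
    rcases Finset.mem_union.mp (h (Finset.mem_union_left T hx)) with h | h
    · exact h
    · exact absurd h (Finset.disjoint_left.mp hST hx)
  induction T using Finset.strongInduction with
  | H T ihT =>
    rintro S hS hST rfl
    refine constOn_mem_of_below_mem hS hST (hφ S T hST rfl) ?_
    rcases T.eq_empty_or_nonempty with rfl | hT
    · rw [ind_eq_one (p := Below S ∅) (by simp [Below]),
        ind_eq_one (p := SamePattern ∅ u) (by simp [SamePattern]), one_mul]
      exact one_mem_layerSpan _
    · -- Merge `S` with the lowest block `Z` of the pattern: the term of `S` equals, up to sign,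
      -- the one of a block `S ∪ Z`, below a shorter pattern.
      obtain ⟨Z, hZT, hZ, hZeq⟩ := exists_block_samePattern (β := β) u hT
      have hSZ : Disjoint S Z := Finset.disjoint_of_subset_right hZT hST
      have hdisj : Disjoint (S ∪ Z) (T \ Z) := Finset.disjoint_union_left.mpr
        ⟨Finset.disjoint_of_subset_right Finset.sdiff_subset hST, Finset.disjoint_sdiff⟩
      have hun : S ∪ Z ∪ T \ Z = S ∪ T := by
        rw [Finset.union_assoc, Finset.union_sdiff_of_subset hZT]
      have hsd : (S ∪ Z) \ S = Z := by
        rw [Finset.union_sdiff_left, Finset.sdiff_eq_self_of_disjoint hSZ.symm]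
      have hSSZ : S ⊂ S ∪ Z := by
        refine ⟨Finset.subset_union_left, fun h => ?_⟩
        obtain ⟨z, hz⟩ := hZ
        exact Finset.disjoint_left.mp hSZ (h (Finset.mem_union_right _ hz)) hz
      have h1 := isTop_sub_mem hdisj (hφ _ _ hdisj hun) S hSSZ
      have h2 := ihT (T \ Z) (Finset.sdiff_ssubset hZT hZ) (S ∪ Z)
        (hS.mono Finset.subset_union_left) hdisj hun
      rw [hun, hsd, ind_congr (p := IsTop (S ∪ Z) (S ∪ Z)) (q := ConstOn (S ∪ Z))
        fun r => by simp [IsTop, Below]] at h1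
      have h3 := (Submodule.sub_mem_iff_left _ (Submodule.smul_mem _ _ h2)).mp h1
      convert h3 using 1
      rw [hZeq]
      simp only [← mul_assoc]
      congr 1
      simp only [ind_mul]
      refine ind_congr fun r => ?_
      simp only [IsTop, Finset.union_sdiff_right, Finset.sdiff_eq_self_of_disjoint hSZ]
      constructor
      · rintro ⟨⟨h1, h2⟩, h3⟩
        refine ⟨⟨fun x hx y hy => h1 x hx y (hZT hy), h2⟩, fun x hx y hy => ?_⟩
        rcases Finset.mem_union.mp hx with hx | hx
        · exact h1 x hx y (Finset.sdiff_subset hy)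
        · exact h3 x hx y hy
      · rintro ⟨⟨h1, h2⟩, h3⟩
        refine ⟨⟨fun x hx y hy => ?_, h2⟩,
          fun x hx y hy => h3 x (Finset.mem_union_right _ hx) y hy⟩
        by_cases hyZ : y ∈ Z
        · exact h1 x hx y hyZ
        · exact h3 x (Finset.mem_union_left _ hx) y (Finset.mem_sdiff.mpr ⟨hy, hyZ⟩)

/-- The generating functions of the layered posets on `S` span all word monomial functions. -/
theorem samePattern_mem_layerSpan (S : Finset α) (u : α → ℕ) :
    ind (SamePattern S u) ∈ layerSpan β S := by
  induction S using Finset.strongInduction generalizing u with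
  | H S ih =>
    rcases S.eq_empty_or_nonempty with rfl | hS
    · rw [ind_eq_one (p := SamePattern ∅ u) (by simp [SamePattern])]
      exact one_mem_layerSpan _
    · obtain ⟨Z, hZS, hZ, hZeq⟩ := exists_block_samePattern (β := β) u hS
      rw [hZeq, mul_assoc]
      exact constOn_below_samePattern_mem u ih (S \ Z) Z hZ Finset.disjoint_sdiff
        (Finset.union_sdiff_of_subset hZS)

end Patterns

/-! ### Linear independence from spanning -/

theorem linearIndependent_of_eval {ι X : Type*} [DecidableEq ι] {f : ι → X → ℤ} (x : ι → X)
    (h : ∀ i j, f i (x j) = if i = j then 1 else 0) : LinearIndependent ℤ f := by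
  refine linearIndependent_iff'.mpr fun s g hg i hi => ?_
  have := congrFun hg (x i)
  simpa [Finset.sum_apply, h, hi] using this

/-- A graded family of functions with finitely many members in each degree is linearly independent
if, degree by degree, it has the same span as a linearly independent family with the same index
set: a generating family of a free module of rank `d` over a commutative ring is a basis as soon as
it has `d` members. -/
theorem linearIndependent_of_graded_span {X : Type*} (deg : X → ℕ) {ι : ℕ → Type*}
    [∀ n, Finite (ι n)] (p v : (Σ n, ι n) → X → ℤ) (hdeg : ∀ i x, v i x ≠ 0 → deg x = i.1)
    (hp : ∀ n, LinearIndependent ℤ fun i : ι n => p ⟨n, i⟩)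
    (hpv : ∀ n i, p ⟨n, i⟩ ∈ Submodule.span ℤ (Set.range fun j : ι n => v ⟨n, j⟩))
    (hvp : ∀ n i, v ⟨n, i⟩ ∈ Submodule.span ℤ (Set.range fun j : ι n => p ⟨n, j⟩)) :
    LinearIndependent ℤ v := by
  have hv : ∀ n, LinearIndependent ℤ fun i : ι n => v ⟨n, i⟩ := by
    intro n
    have := Fintype.ofFinite (ι n)
    have h := linearIndependent_iff_card_eq_finrank_span.mp (hp n)
    have hspan : Submodule.span ℤ (Set.range fun i : ι n => p ⟨n, i⟩) =
        Submodule.span ℤ (Set.range fun i : ι n => v ⟨n, i⟩) :=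
      le_antisymm (Submodule.span_le.mpr (by rintro _ ⟨i, rfl⟩; exact hpv n i))
        (Submodule.span_le.mpr (by rintro _ ⟨i, rfl⟩; exact hvp n i))
    rw [linearIndependent_iff_card_eq_finrank_span, h, Set.finrank, Set.finrank, hspan]
  refine linearIndependent_iff'.mpr ?_
  rintro s g hg ⟨n, i⟩ hi
  have hinj := sigma_mk_injective (β := ι) (i := n)
  refine linearIndependent_iff'.mp (hv n) (s.preimage (Sigma.mk n) hinj.injOn)
    (fun j => g ⟨n, j⟩) ?_ i (by simpa using hi)
  ext x
  by_cases hx : deg x = n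
  · rw [Finset.sum_apply, Finset.sum_preimage (Sigma.mk n) s hinj.injOn fun j => (g j • v j) x,
      ← Finset.sum_apply, hg]
    rintro ⟨m, j⟩ - hj
    have : v ⟨m, j⟩ x = 0 := by
      by_contra h
      obtain rfl : n = m := hx.symm.trans (hdeg _ _ h)
      exact hj ⟨j, rfl⟩
    simp [this]
  · rw [Finset.sum_apply]
    refine Finset.sum_eq_zero fun j _ => ?_
    have : v ⟨n, j⟩ x = 0 := by
      by_contra h
      exact hx (hdeg _ _ h)
    simp [this]

/-! ### Series supported on the words of a given length -/

/-- The series whose coefficient at a word of length `n` is the value of `φ` at its sequence of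
letters, and whose other coefficients vanish. -/
def wordSeries (n : ℕ) : ((Fin n → ℕ+) → ℤ) →ₗ[ℤ] NCSeries where
  toFun φ w := if h : w.length = n then φ fun i => w.get (i.cast h.symm) else 0
  map_add' φ ψ := by
    ext w
    by_cases h : w.length = n <;> simp [h]
  map_smul' a φ := by
    ext w
    by_cases h : w.length = n <;> simp [h]

theorem wordSeries_apply_ofFn {n : ℕ} (φ : (Fin n → ℕ+) → ℤ) (r : Fin n → ℕ+) :
    wordSeries n φ (List.ofFn r) = φ r := by
  simp [wordSeries]

theorem wordSeries_apply_of_length_ne {n : ℕ} (φ : (Fin n → ℕ+) → ℤ) {w : List ℕ+}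
    (h : w.length ≠ n) : wordSeries n φ w = 0 := by
  simp [wordSeries, h]

theorem exists_eq_ofFn {n : ℕ} {w : List ℕ+} (h : w.length = n) :
    ∃ r : Fin n → ℕ+, w = List.ofFn r := by
  subst h
  exact ⟨w.get, (List.ofFn_get w).symm⟩

theorem eq_wordSeries {n : ℕ} {f : NCSeries} {φ : (Fin n → ℕ+) → ℤ}
    (h : ∀ r, f (List.ofFn r) = φ r) (h' : ∀ w : List ℕ+, w.length ≠ n → f w = 0) :
    f = wordSeries n φ := by
  ext w
  by_cases hw : w.length = n
  · obtain ⟨r, rfl⟩ := exists_eq_ofFn hw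
    rw [h, wordSeries_apply_ofFn]
  · rw [h' w hw, wordSeries_apply_of_length_ne φ hw]

theorem RankedPoset.ncF_eq {n : ℕ} (P : RankedPoset n) :
    P.ncF = wordSeries n (ind P.OrderCondition) := by
  refine eq_wordSeries (fun r => ?_) fun w hw => ?_
  · by_cases h : P.OrderCondition r
    · have : {r' : Fin n → ℕ+ | P.OrderCondition r' ∧ List.ofFn r' = List.ofFn r} = {r} := by
        ext r'
        simp only [List.ofFn_inj, Set.mem_ofPred_eq, Set.mem_singleton_iff]
        exact ⟨fun h => h.2, fun h' => ⟨h' ▸ h, h'⟩⟩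
      rw [RankedPoset.ncF, this]
      simp [ind, h]
    · have : {r' : Fin n → ℕ+ | P.OrderCondition r' ∧ List.ofFn r' = List.ofFn r} = ∅ := by
        ext r'
        simp only [List.ofFn_inj, Set.mem_ofPred_eq, Set.mem_empty_iff_false, iff_false]
        rintro ⟨h', rfl⟩
        exact h h'
      rw [RankedPoset.ncF, this]
      simp [ind, h]
  · have : {r : Fin n → ℕ+ | P.OrderCondition r ∧ List.ofFn r = w} = ∅ := by
      ext r
      simp only [Set.mem_ofPred_eq, Set.mem_empty_iff_false, iff_false]
      rintro ⟨-, rfl⟩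
      simp at hw
    simp [RankedPoset.ncF, this]

/-! ### Set compositions as layerings -/

namespace SetComposition

variable {n : ℕ} (K : SetComposition n)

/-- The height of `x` in the layered poset, as a natural number. -/
def level (x : Fin n) : ℕ := K.index x

theorem mem_part_iff {x : Fin n} {i : Fin K.length} : x ∈ K.part i ↔ K.index x = i :=
  ⟨K.index_eq, fun h => h ▸ K.mem_index x⟩

theorem index_surjective : Function.Surjective K.index := fun i => by
  obtain ⟨x, hx⟩ := K.nonempty i
  exact ⟨x, K.index_eq hx⟩

theorem isLayering_level : IsLayering Finset.univ K.level := fun x _ j hj => by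
  obtain ⟨y, hy⟩ := K.index_surjective ⟨j, hj.trans (K.index x).isLt⟩
  exact ⟨y, Finset.mem_univ y, congrArg Fin.val hy⟩

theorem ext_level {K L : SetComposition n} (h : K.level = L.level) : K = L := by
  have key : ∀ K L : SetComposition n, K.level = L.level → K.length ≤ L.length := by
    intro K L h
    by_contra! hlt
    obtain ⟨x, hx⟩ := K.index_surjective ⟨L.length, hlt⟩
    have h1 : K.level x = L.length := congrArg Fin.val hx
    have h2 : L.level x < L.length := (L.index x).isLt
    rw [h] at h1
    omega
  have hlen := le_antisymm (key K L h) (key L K h.symm)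
  obtain ⟨l, pK, neK, dK, cK⟩ := K
  obtain ⟨l', pL, neL, dL, cL⟩ := L
  obtain rfl : l = l' := hlen
  obtain rfl : pK = pL := by
    ext i x
    have h1 := mem_part_iff ⟨l, pK, neK, dK, cK⟩ (x := x) (i := i)
    have h2 := mem_part_iff ⟨l, pL, neL, dL, cL⟩ (x := x) (i := i)
    simp only at h1 h2
    rw [h1, h2, Fin.ext_iff, Fin.ext_iff]
    exact iff_of_eq (congrArg (· = (i : ℕ)) (congrFun h x))
  rfl

theorem exists_level_eq {k : Fin n → ℕ} (hk : IsLayering Finset.univ k) :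
    ∃ K : SetComposition n, K.level = k := by
  set m := Finset.univ.sup fun x => k x + 1 with hm
  have hlt : ∀ x, k x < m := fun x =>
    Nat.lt_of_succ_le (Finset.le_sup (f := fun x => k x + 1) (Finset.mem_univ x))
  refine ⟨⟨m, fun i => Finset.univ.filter fun x => k x = i, fun i => ?_, fun i j hij => ?_,
    fun x => ⟨⟨k x, hlt x⟩, by simp⟩⟩, ?_⟩
  · obtain ⟨x, -, hx⟩ := (Finset.lt_sup_iff (f := fun x => k x + 1)).mp i.isLt
    rcases (Nat.lt_succ_iff.mp hx).lt_or_eq with h | h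
    · obtain ⟨y, -, hy⟩ := hk x (Finset.mem_univ x) i h
      exact ⟨y, by simp [hy]⟩
    · exact ⟨x, by simp [h]⟩
  · refine Finset.disjoint_left.mpr fun x hi hj => hij (Fin.ext ?_)
    simp only [Finset.mem_filter, Finset.mem_univ, true_and] at hi hj
    rw [← hi, ← hj]
  · ext x
    refine congrArg Fin.val (index_eq _ (i := ⟨k x, hlt x⟩) ?_)
    simp

theorem length_le : K.length ≤ n := by
  simpa using Fintype.card_le_of_surjective _ K.index_surjective

instance : Finite (SetComposition n) := by
  refine Finite.of_injective (β := Fin n → Fin n)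
    (fun K x => ⟨K.level x, (K.index x).isLt.trans_le K.length_le⟩) fun K L h => ext_level ?_
  ext x
  exact congrArg Fin.val (congrFun h x)

theorem reflTransGen_of_level_lt {x y : Fin n} (h : K.level x < K.level y) :
    Relation.ReflTransGen K.Rel x y := by
  obtain ⟨d, hd⟩ : ∃ d, K.level y = K.level x + d + 1 := ⟨K.level y - K.level x - 1, by omega⟩
  induction d generalizing y with
  | zero =>
    exact .single ⟨K.index x, K.index y, by simpa [level] using hd, K.mem_index x, K.mem_index y⟩
  | succ d ih =>
    obtain ⟨z, -, hz⟩ := K.isLayering_level y (Finset.mem_univ y) (K.level x + d + 1) (by omega)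
    refine (ih (by omega) hz).tail ⟨K.index z, K.index y, ?_, K.mem_index z, K.mem_index y⟩
    change K.level y = K.level z + 1
    omega

theorem orderCondition_iff (r : Fin n → ℕ+) :
    K.poset.OrderCondition r ↔ LayerCond Finset.univ K.level r := by
  constructor
  · intro h x _ y _ hxy
    have hle := K.reflTransGen_of_level_lt hxy
    refine ⟨h.1 x y hle, h.2 x y ⟨hle, fun h' => ?_⟩⟩
    rcases K.eq_or_index_lt h' with rfl | h'
    · exact lt_irrefl _ hxy
    · exact lt_asymm hxy h'
  · intro h
    refine ⟨fun x y hxy => ?_, fun x y hxy => ?_⟩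
    · rcases K.eq_or_index_lt hxy with rfl | h'
      · exact le_rfl
      · exact (h x (Finset.mem_univ x) y (Finset.mem_univ y) h').1
    · rcases K.eq_or_index_lt hxy.1 with rfl | h'
      · exact absurd hxy.1 hxy.2
      · exact (h x (Finset.mem_univ x) y (Finset.mem_univ y) h').2

theorem ncF_eq : K.poset.ncF = wordSeries n (ind (LayerCond Finset.univ K.level)) := by
  rw [RankedPoset.ncF_eq, ind_congr K.orderCondition_iff]

/-- The packed word whose `x`-th letter is the index of the part of `K` containing `x`, the parts
being numbered from `1`. -/
def word (x : Fin n) : ℕ+ := Nat.succPNat (K.level x)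

theorem word_lt_word {x y : Fin n} : K.word x < K.word y ↔ K.level x < K.level y := by
  simp [word]

/-- The word monomial function of the packed word of `K`. -/
def ncM : NCSeries := wordSeries n (ind (SamePattern Finset.univ K.level))

end SetComposition

open SetComposition

/-! ### Packing -/

/-- Together with its mirror image, this says that a layering is determined by the order in which it
places the positions. -/
theorem IsLayering.le_of_samePattern {n : ℕ} {k l : Fin n → ℕ} (hl : IsLayering Finset.univ l)
    (h : ∀ x y, k x < k y ↔ l x < l y) (x : Fin n) : l x ≤ k x := by
  induction hx : k x using Nat.strong_induction_on generalizing x with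
  | _ m ih =>
    by_contra! hlt
    obtain ⟨y, -, hy⟩ := hl x (Finset.mem_univ x) m hlt
    have h1 : k y < k x := (h y x).mpr (by omega)
    have := ih (k y) (by omega) y rfl
    omega

theorem IsLayering.eq_of_samePattern {n : ℕ} {k l : Fin n → ℕ} (hk : IsLayering Finset.univ k)
    (hl : IsLayering Finset.univ l) (h : ∀ x y, k x < k y ↔ l x < l y) : k = l :=
  funext fun x => le_antisymm (hk.le_of_samePattern (fun x y => (h x y).symm) x)
    (hl.le_of_samePattern h x)

/-- The number of distinct letters of `r` smaller than its `x`-th letter. -/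
def rank {n : ℕ} (r : Fin n → ℕ+) (x : Fin n) : ℕ :=
  ((Finset.univ.image r).filter (· < r x)).card

theorem pack_ofFn {n : ℕ} (r : Fin n → ℕ+) :
    pack (List.ofFn r) = List.ofFn fun x => Nat.succPNat (rank r x) := by
  have : (List.ofFn r).toFinset = Finset.univ.image r := by
    ext a
    simp [List.mem_ofFn]
  rw [pack, List.map_ofFn, this]
  rfl

theorem rank_lt_rank {n : ℕ} (r : Fin n → ℕ+) (x y : Fin n) : rank r x < rank r y ↔ r x < r y := by
  have mono : ∀ {x y}, r x ≤ r y → rank r x ≤ rank r y := fun h =>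
    Finset.card_le_card (Finset.monotone_filter_right _ fun a _ ha => lt_of_lt_of_le ha h)
  constructor
  · intro h
    by_contra! h'
    exact absurd (mono h') h.not_ge
  · intro h
    refine Finset.card_lt_card ⟨Finset.monotone_filter_right _ fun a _ ha => lt_trans ha h,
      fun hsub => ?_⟩
    have := hsub (Finset.mem_filter.mpr ⟨Finset.mem_image_of_mem r (Finset.mem_univ x), h⟩)
    exact lt_irrefl _ (Finset.mem_filter.mp this).2

theorem isLayering_rank {n : ℕ} (r : Fin n → ℕ+) : IsLayering Finset.univ (rank r) := by
  have step : ∀ x t, rank r x = t + 1 → ∃ y, rank r y = t := by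
    intro x t hx
    -- The largest letter below the `x`-th one has rank one less.
    have hne : ((Finset.univ.image r).filter (· < r x)).Nonempty := by
      rw [← Finset.card_pos]
      unfold rank at hx
      omega
    obtain ⟨b, hb, hmax⟩ := Finset.exists_max_image _ id hne
    obtain ⟨hb1, hb2⟩ := Finset.mem_filter.mp hb
    obtain ⟨y, -, rfl⟩ := Finset.mem_image.mp hb1
    refine ⟨y, ?_⟩
    have : (Finset.univ.image r).filter (· < r x) =
        insert (r y) ((Finset.univ.image r).filter (· < r y)) := by
      ext a
      rw [Finset.mem_insert, Finset.mem_filter, Finset.mem_filter]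
      constructor
      · intro ha
        rcases (hmax a (Finset.mem_filter.mpr ha)).lt_or_eq with h | h
        · exact Or.inr ⟨ha.1, h⟩
        · exact Or.inl h
      · rintro (rfl | ha)
        · exact ⟨hb1, hb2⟩
        · exact ⟨ha.1, ha.2.trans hb2⟩
    rw [rank, this, Finset.card_insert_of_notMem (by simp)] at hx
    exact Nat.succ_injective hx
  intro x _ j hj
  obtain ⟨d, hd⟩ : ∃ d, rank r x = j + d + 1 := ⟨rank r x - j - 1, by omega⟩
  clear hj
  induction d generalizing x with
  | zero =>
    obtain ⟨y, hy⟩ := step x j hd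
    exact ⟨y, Finset.mem_univ y, hy⟩
  | succ d ih =>
    obtain ⟨y, hy⟩ := step x (j + d + 1) hd
    exact ih y (Finset.mem_univ y) hy

theorem samePattern_level_iff {n : ℕ} (K : SetComposition n) (r : Fin n → ℕ+) :
    SamePattern Finset.univ K.level r ↔ rank r = K.level := by
  constructor
  · intro h
    exact (isLayering_rank r).eq_of_samePattern K.isLayering_level fun x y =>
      (rank_lt_rank r x y).trans (h x (Finset.mem_univ x) y (Finset.mem_univ y))
  · intro h x _ y _
    rw [← h, rank_lt_rank]

theorem ncM_word {n : ℕ} (K : SetComposition n) : WordQSym.ncM (List.ofFn K.word) = K.ncM := by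
  refine eq_wordSeries (fun r => ?_) fun w hw => ?_
  · simp only [WordQSym.ncM, pack_ofFn, ind, samePattern_level_iff]
    congr 1
    rw [List.ofFn_inj, funext_iff, funext_iff]
    simp [SetComposition.word]
  · refine if_neg fun h => hw ?_
    simpa [pack] using congrArg List.length h

theorem isPacked_word {n : ℕ} (K : SetComposition n) : IsPacked (List.ofFn K.word) := by
  intro a ha b hb
  obtain ⟨x, rfl⟩ := (List.mem_ofFn' _ _).mp ha
  rcases hb.lt_or_eq with hb | rfl
  · have hb' : b.natPred < K.level x := by
      simpa [word] using PNat.natPred_lt_natPred.mpr hb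
    obtain ⟨y, -, hy⟩ := K.isLayering_level x (Finset.mem_univ x) _ hb'
    exact (List.mem_ofFn' _ _).mpr ⟨y, by simp [word, hy]⟩
  · exact ha

theorem IsPacked.exists_word {u : List ℕ+} (hu : IsPacked u) :
    ∃ (n : ℕ) (K : SetComposition n), u = List.ofFn K.word := by
  obtain ⟨r, hr⟩ := exists_eq_ofFn (w := u) rfl
  have hk : IsLayering Finset.univ fun x => (r x).natPred := by
    intro x _ j hj
    have hle : Nat.succPNat j ≤ r x := by
      rw [← PNat.succPNat_natPred (r x)]
      exact Nat.succPNat_le_succPNat.mpr hj.le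
    have hmem : r x ∈ u := by
      rw [hr]
      exact (List.mem_ofFn' _ _).mpr ⟨x, rfl⟩
    have := hu _ hmem _ hle
    rw [hr] at this
    obtain ⟨y, hy⟩ := (List.mem_ofFn' _ _).mp this
    exact ⟨y, Finset.mem_univ y, by simp [hy]⟩
  obtain ⟨K, hK⟩ := exists_level_eq hk
  refine ⟨u.length, K, hr.trans (congrArg List.ofFn (funext fun x => ?_))⟩
  simp [word, hK]

/-! ### The basis of `WQSym` -/

theorem WQSym_eq_span :
    WQSym = Submodule.span ℤ (Set.range fun K : Σ n, SetComposition n => K.2.ncM) := by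
  refine congrArg (Submodule.span ℤ) (Set.ext fun f => ⟨?_, ?_⟩)
  · rintro ⟨u, hu, rfl⟩
    obtain ⟨n, K, rfl⟩ := IsPacked.exists_word hu
    exact ⟨⟨n, K⟩, (ncM_word K).symm⟩
  · rintro ⟨⟨n, K⟩, rfl⟩
    exact ⟨List.ofFn K.word, isPacked_word K, ncM_word K⟩

/-- A series whose coefficients only depend on the packing of the word is word quasi-symmetric:
`rank` is the packing up to a shift by one. -/
theorem wordSeries_mem_span_ncM {n : ℕ} {φ : (Fin n → ℕ+) → ℤ}
    (hφ : ∀ r s : Fin n → ℕ+, rank r = rank s → φ r = φ s) :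
    wordSeries n φ ∈ Submodule.span ℤ (Set.range fun K : SetComposition n => K.ncM) := by
  have := Fintype.ofFinite (SetComposition n)
  have h : φ = ∑ K : SetComposition n, φ K.word • ind (SamePattern Finset.univ K.level) := by
    ext r
    obtain ⟨K, hK⟩ := exists_level_eq (isLayering_rank r)
    rw [Finset.sum_apply, Finset.sum_eq_single K]
    · have h1 : SamePattern Finset.univ K.level r := (samePattern_level_iff K r).mpr hK.symm
      have h2 : rank K.word = K.level :=
        (samePattern_level_iff K K.word).mp fun x _ y _ => K.word_lt_word
      simp [ind, h1, hφ r K.word (by rw [h2, hK])]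
    · intro L _ hL
      have h1 : ¬ SamePattern Finset.univ L.level r := fun h =>
        hL (ext_level (((samePattern_level_iff L r).mp h).symm.trans hK.symm))
      simp [ind, h1]
    · simp
  rw [h, map_sum]
  refine sum_mem fun K _ => ?_
  rw [map_smul]
  exact Submodule.smul_mem _ _ (Submodule.subset_span ⟨K, rfl⟩)

theorem ncF_mem_span_ncM {n : ℕ} (K : SetComposition n) :
    K.poset.ncF ∈ Submodule.span ℤ (Set.range fun K : SetComposition n => K.ncM) := by
  rw [K.ncF_eq]
  refine wordSeries_mem_span_ncM fun r s h => ?_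
  have hlt : ∀ x y, r x < r y ↔ s x < s y := fun x y => by
    rw [← rank_lt_rank, ← rank_lt_rank, h]
  have hle : ∀ x y, r x ≤ r y ↔ s x ≤ s y := fun x y => by
    rw [← not_lt, ← not_lt, hlt]
  classical
  exact if_congr (by simp only [LayerCond, hlt, hle]) rfl rfl

theorem ncM_mem_span_ncF {n : ℕ} (K : SetComposition n) :
    K.ncM ∈ Submodule.span ℤ (Set.range fun K : SetComposition n => K.poset.ncF) := by
  have h := Submodule.mem_map_of_mem (f := wordSeries n)
    (samePattern_mem_layerSpan (β := ℕ+) Finset.univ K.level)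
  rw [layerSpan, Submodule.map_span] at h
  refine Submodule.span_mono ?_ h
  rintro _ ⟨_, ⟨k, hk, rfl⟩, rfl⟩
  obtain ⟨L, rfl⟩ := exists_level_eq hk
  exact ⟨L, L.ncF_eq⟩

theorem span_ncF_eq : Submodule.span ℤ
    (Set.range fun K : Σ n, SetComposition n => K.2.poset.ncF) = WQSym := by
  rw [WQSym_eq_span]
  refine le_antisymm (Submodule.span_le.mpr ?_) (Submodule.span_le.mpr ?_)
  · rintro _ ⟨⟨n, K⟩, rfl⟩
    refine Submodule.span_mono ?_ (ncF_mem_span_ncM K)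
    rintro _ ⟨L, rfl⟩
    exact ⟨⟨n, L⟩, rfl⟩
  · rintro _ ⟨⟨n, K⟩, rfl⟩
    refine Submodule.span_mono ?_ (ncM_mem_span_ncF K)
    rintro _ ⟨L, rfl⟩
    exact ⟨⟨n, L⟩, rfl⟩

theorem linearIndependent_ncM (n : ℕ) :
    LinearIndependent ℤ fun K : SetComposition n => K.ncM := by
  classical
  refine linearIndependent_of_eval (fun K => List.ofFn K.word) fun K L => ?_
  have h2 : rank L.word = L.level :=
    (samePattern_level_iff L L.word).mp fun x _ y _ => L.word_lt_word
  rw [SetComposition.ncM, wordSeries_apply_ofFn, ind, samePattern_level_iff, h2]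
  by_cases h : K = L
  · simp [h]
  · rw [if_neg h, if_neg fun h' => h (ext_level h'.symm)]

theorem linearIndependent_ncF :
    LinearIndependent ℤ fun K : Σ n, SetComposition n => K.2.poset.ncF := by
  refine linearIndependent_of_graded_span List.length
    (fun K : Σ n, SetComposition n => K.2.ncM) _ (fun K w hw => ?_) linearIndependent_ncM
    (fun _ => ncM_mem_span_ncF) fun _ => ncF_mem_span_ncM
  by_contra h
  rw [K.2.ncF_eq, wordSeries_apply_of_length_ne _ h] at hw
  exact hw rfl

/-! ### Commutative images -/

/-- The exponent vector of the monomial `x_{r(1)} ⋯ x_{r(n)}`. -/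
def content {n : ℕ} (r : Fin n → ℕ+) : ℕ+ →₀ ℕ := ∑ i, Finsupp.single (r i) 1

theorem degree_content {n : ℕ} (r : Fin n → ℕ+) : (content r).degree = n := by
  simp [content, map_sum]

theorem content_comp_perm {n : ℕ} (r : Fin n → ℕ+) (σ : Equiv.Perm (Fin n)) :
    content (r ∘ σ) = content r :=
  Equiv.sum_comp σ fun i => Finsupp.single (r i) 1

theorem ofFn_mem_lists_iff {n : ℕ} (r : Fin n → ℕ+) (m : ℕ+ →₀ ℕ) :
    List.ofFn r ∈ (Finsupp.toMultiset m).lists.toFinset ↔ content r = m := by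
  have : Finsupp.toMultiset (content r) = (List.ofFn r : Multiset ℕ+) := by
    simp only [content, Finsupp.toMultiset_sum, Finsupp.toMultiset_single, one_smul]
    rw [← Multiset.sum_map_singleton (List.ofFn r : Multiset ℕ+), Multiset.map_coe,
      Multiset.sum_coe, List.map_ofFn, List.sum_ofFn]
    rfl
  rw [Multiset.mem_toFinset, Multiset.mem_lists_iff]
  change Finsupp.toMultiset m = (List.ofFn r : Multiset ℕ+) ↔ _
  rw [← this]
  exact (Multiset.toFinsupp.symm.injective.eq_iff (a := m) (b := content r)).trans eq_comm

/-- `commImage` as a linear map. -/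
def commImageHom : NCSeries →ₗ[ℤ] MvPowerSeries ℕ+ ℤ where
  toFun := commImage
  map_add' f g := funext fun m => by
    exact Finset.sum_add_distrib
  map_smul' a f := funext fun m => by
    exact (Finset.smul_sum (r := a) (f := f)).symm

theorem commImage_wordSeries_ind {n : ℕ} (Q : (Fin n → ℕ+) → Prop) (m : ℕ+ →₀ ℕ) :
    commImage (wordSeries n (ind Q)) m = ({r | Q r ∧ content r = m}.ncard : ℤ) := by
  classical
  have hcoe : (((Finsupp.toMultiset m).lists.toFinset.filter fun w =>
      ∃ r, Q r ∧ w = List.ofFn r : Finset (List ℕ+)) : Set (List ℕ+)) =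
      List.ofFn '' {r | Q r ∧ content r = m} := by
    ext w
    simp only [Finset.coe_filter, Set.mem_ofPred_eq, Set.mem_image]
    constructor
    · rintro ⟨hw, r, hr, rfl⟩
      exact ⟨r, ⟨hr, (ofFn_mem_lists_iff r m).mp hw⟩, rfl⟩
    · rintro ⟨r, ⟨hr, hm⟩, rfl⟩
      exact ⟨(ofFn_mem_lists_iff r m).mpr hm, r, hr, rfl⟩
  rw [← Set.ncard_image_of_injective _ List.ofFn_injective, ← hcoe, Set.ncard_coe_finset,
    Finset.natCast_card_filter]
  refine Finset.sum_congr rfl fun w _ => ?_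
  by_cases hw : w.length = n
  · obtain ⟨r, rfl⟩ := exists_eq_ofFn hw
    rw [wordSeries_apply_ofFn]
    by_cases h : Q r <;> simp [ind, h]
  · rw [wordSeries_apply_of_length_ne _ hw, if_neg]
    rintro ⟨r, -, rfl⟩
    simp at hw

theorem RankedPoset.commImage_ncF {n : ℕ} (P : RankedPoset n) : commImage P.ncF = P.F := by
  funext m
  rw [P.ncF_eq, commImage_wordSeries_ind]
  rfl

/-- Renumbering the positions does not change the commutative image. -/
theorem commImage_wordSeries_ind_comp {n : ℕ} (Q : (Fin n → ℕ+) → Prop)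
    (σ : Equiv.Perm (Fin n)) :
    commImage (wordSeries n (ind fun r => Q (r ∘ σ))) = commImage (wordSeries n (ind Q)) := by
  funext m
  rw [commImage_wordSeries_ind, commImage_wordSeries_ind]
  have hinj : Function.Injective fun r : Fin n → ℕ+ => r ∘ σ := σ.surjective.injective_comp_right
  rw [← Set.ncard_image_of_injective _ hinj]
  congr 2
  ext r
  simp only [Set.mem_image, Set.mem_ofPred_eq]
  constructor
  · rintro ⟨s, ⟨hs, hm⟩, rfl⟩
    exact ⟨hs, by rw [content_comp_perm, hm]⟩
  · rintro ⟨hr, hm⟩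
    have : (r ∘ σ.symm) ∘ σ = r := by
      ext x
      simp
    exact ⟨r ∘ σ.symm, ⟨by rwa [this], by rw [content_comp_perm, hm]⟩, this⟩

theorem commImage_layer_comp {n : ℕ} (k : Fin n → ℕ) (σ : Equiv.Perm (Fin n)) :
    commImage (wordSeries n (ind (LayerCond Finset.univ (k ∘ σ)))) =
      commImage (wordSeries n (ind (LayerCond Finset.univ k))) := by
  rw [← commImage_wordSeries_ind_comp (LayerCond Finset.univ k) σ.symm]
  refine congrArg (fun φ => commImage (wordSeries n φ)) (ind_congr fun r => ⟨fun h x _ y _ => ?_,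
    fun h x _ y _ => ?_⟩)
  · simpa using h (σ.symm x) (Finset.mem_univ _) (σ.symm y) (Finset.mem_univ _)
  · simpa using h (σ x) (Finset.mem_univ _) (σ y) (Finset.mem_univ _)

theorem commImage_pattern_comp {n : ℕ} (k : Fin n → ℕ) (σ : Equiv.Perm (Fin n)) :
    commImage (wordSeries n (ind (SamePattern Finset.univ (k ∘ σ)))) =
      commImage (wordSeries n (ind (SamePattern Finset.univ k))) := by
  rw [← commImage_wordSeries_ind_comp (SamePattern Finset.univ k) σ.symm]
  refine congrArg (fun φ => commImage (wordSeries n φ)) (ind_congr fun r => ⟨fun h x _ y _ => ?_,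
    fun h x _ y _ => ?_⟩)
  · simpa using h (σ.symm x) (Finset.mem_univ _) (σ.symm y) (Finset.mem_univ _)
  · simpa using h (σ x) (Finset.mem_univ _) (σ y) (Finset.mem_univ _)

/-! ### Dependence on the sizes of the layers only -/

theorem level_ofComposition {n : ℕ} (I : Composition n) (x : Fin n) :
    (ofComposition I).level x = I.index x :=
  congrArg Fin.val ((ofComposition I).index_eq (i := I.index x) (by simp [ofComposition]))

theorem card_index_eq {n : ℕ} (I : Composition n) (k : Fin I.length) :
    (Finset.univ.filter fun x => I.index x = k).card = I.blocksFun k := by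
  have : (Finset.univ.filter fun x => I.index x = k) =
      Finset.univ.map (I.embedding k).toEmbedding := by
    ext x
    simp only [Finset.mem_filter, Finset.mem_univ, true_and, Finset.mem_map]
    have := I.mem_range_embedding_iff' (j := x) (i := k)
    simp only [Set.mem_range] at this
    rw [eq_comm, ← this]
    rfl
  rw [this, Finset.card_map, Finset.card_univ, Fintype.card_fin]

theorem card_level_ofComposition {n : ℕ} (I : Composition n) (j : ℕ) :
    (Finset.univ.filter fun x => (ofComposition I).level x = j).card = I.blocks.getD j 0 := by
  simp only [level_ofComposition]
  by_cases hj : j < I.length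
  · rw [List.getD_eq_getElem _ _ hj]
    refine Eq.trans ?_ (card_index_eq I ⟨j, hj⟩)
    simp [Fin.ext_iff]
  · rw [List.getD_eq_default _ _ (not_lt.mp hj), Finset.card_eq_zero,
      Finset.filter_eq_empty_iff]
    rintro x - rfl
    exact hj (I.index x).isLt

theorem card_level {n : ℕ} (K : SetComposition n) (j : ℕ) :
    (Finset.univ.filter fun x => K.level x = j).card = K.type.blocks.getD j 0 := by
  by_cases hj : j < K.length
  · have h : K.type.blocks.getD j 0 = (K.part ⟨j, hj⟩).card := by
      simp [SetComposition.type, hj]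
    rw [h]
    congr 1
    ext x
    rw [Finset.mem_filter, K.mem_part_iff, Fin.ext_iff]
    exact and_iff_right (Finset.mem_univ x)
  · rw [List.getD_eq_default _ _ (by simpa [SetComposition.type] using hj), Finset.card_eq_zero,
      Finset.filter_eq_empty_iff]
    rintro x - rfl
    exact hj (K.index x).isLt

theorem exists_perm_level {n : ℕ} (K : SetComposition n) :
    ∃ σ : Equiv.Perm (Fin n), K.level = (ofComposition K.type).level ∘ σ := by
  have e : ∀ j, Nonempty ({x // K.level x = j} ≃ {x // (ofComposition K.type).level x = j}) := by
    intro j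
    refine Fintype.card_eq.mp ?_
    rw [Fintype.card_subtype, Fintype.card_subtype, card_level, card_level_ofComposition]
  exact ⟨Equiv.ofFiberEquiv fun j => (e j).some,
    funext fun x => (Equiv.ofFiberEquiv_map (fun j => (e j).some) x).symm⟩

theorem commImage_ncF {n : ℕ} (K : SetComposition n) :
    commImage K.poset.ncF = layeredF K.type := by
  obtain ⟨σ, hσ⟩ := exists_perm_level K
  rw [layeredF, ← RankedPoset.commImage_ncF, K.ncF_eq, SetComposition.ncF_eq, hσ,
    commImage_layer_comp]

/-! ### The basis of `QSym` -/

theorem content_comp_index {n : ℕ} (I : Composition n) (a : Fin I.length → ℕ+) :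
    content (a ∘ I.index) = ∑ k, Finsupp.single (a k) (I.blocksFun k) := by
  rw [content, ← Finset.sum_fiberwise Finset.univ I.index]
  refine Finset.sum_congr rfl fun k _ => ?_
  rw [Finset.sum_congr rfl (g := fun _ => Finsupp.single (a k) 1) fun x hx => by
    rw [Function.comp_apply, (Finset.mem_filter.mp hx).2], Finset.sum_const, card_index_eq,
    Finsupp.smul_single, smul_eq_mul, mul_one]

theorem index_surjective {n : ℕ} (I : Composition n) : Function.Surjective I.index := fun k =>
  ⟨I.embedding k ⟨0, I.one_le_blocksFun k⟩, I.index_embedding k _⟩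

/-- The words with the pattern of consecutive intervals correspond to the strictly increasing
sequences of letters. -/
theorem commImage_ncM_ofComposition {n : ℕ} (I : Composition n) :
    commImage (ofComposition I).ncM = M I := by
  funext m
  rw [SetComposition.ncM, commImage_wordSeries_ind]
  refine congrArg Nat.cast ?_
  rw [← Set.ncard_image_of_injective _ (index_surjective I).injective_comp_right]
  congr 1
  ext r
  simp only [Set.mem_image, Set.mem_ofPred_eq]
  constructor
  · rintro ⟨h, hm⟩
    have hlt : ∀ x y, r x < r y ↔ I.index x < I.index y := fun x y => by
      rw [h x (Finset.mem_univ x) y (Finset.mem_univ y), level_ofComposition, level_ofComposition,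
        Fin.lt_def]
    choose s hs using index_surjective I
    have hr : (fun k => r (s k)) ∘ I.index = r := by
      funext x
      refine le_antisymm (not_lt.mp fun h => ?_) (not_lt.mp fun h => ?_) <;>
        simpa [hs] using (hlt _ _).mp h
    refine ⟨fun k => r (s k), ⟨fun k l hkl => ?_, ?_⟩, hr⟩
    · rwa [hlt, hs, hs]
    · rw [← content_comp_index, hr, hm]
  · rintro ⟨a, ⟨ha, hm⟩, rfl⟩
    refine ⟨fun x _ y _ => ?_, by rw [content_comp_index, hm]⟩
    rw [level_ofComposition, level_ofComposition, Function.comp_apply, Function.comp_apply,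
      ha.lt_iff_lt, Fin.lt_def]

theorem commImage_ncM {n : ℕ} (K : SetComposition n) : commImage K.ncM = M K.type := by
  obtain ⟨σ, hσ⟩ := exists_perm_level K
  rw [← commImage_ncM_ofComposition, SetComposition.ncM, hσ, commImage_pattern_comp]
  rfl

theorem layeredF_mem_span_M {n : ℕ} (I : Composition n) :
    layeredF I ∈ Submodule.span ℤ (Set.range fun I : Composition n => M I) := by
  have h := Submodule.mem_map_of_mem (f := commImageHom) (ncF_mem_span_ncM (ofComposition I))
  rw [Submodule.map_span] at h
  rw [layeredF, ← RankedPoset.commImage_ncF]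
  refine Submodule.span_mono ?_ h
  rintro _ ⟨_, ⟨K, rfl⟩, rfl⟩
  exact ⟨K.type, (commImage_ncM K).symm⟩

theorem M_mem_span_layeredF {n : ℕ} (I : Composition n) :
    M I ∈ Submodule.span ℤ (Set.range fun I : Composition n => layeredF I) := by
  have h := Submodule.mem_map_of_mem (f := commImageHom) (ncM_mem_span_ncF (ofComposition I))
  rw [Submodule.map_span] at h
  rw [← commImage_ncM_ofComposition]
  refine Submodule.span_mono ?_ h
  rintro _ ⟨_, ⟨K, rfl⟩, rfl⟩
  exact ⟨K.type, (commImage_ncF K).symm⟩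

theorem span_layeredF_eq : Submodule.span ℤ
    (Set.range fun I : Σ n, Composition n => layeredF I.2) = QSym := by
  refine le_antisymm (Submodule.span_le.mpr ?_) (Submodule.span_le.mpr ?_)
  · rintro _ ⟨⟨n, I⟩, rfl⟩
    refine Submodule.span_mono ?_ (layeredF_mem_span_M I)
    rintro _ ⟨J, rfl⟩
    exact ⟨⟨n, J⟩, rfl⟩
  · rintro _ ⟨⟨n, I⟩, rfl⟩
    refine Submodule.span_mono ?_ (M_mem_span_layeredF I)
    rintro _ ⟨J, rfl⟩
    exact ⟨⟨n, J⟩, rfl⟩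

/-- The monomial `x_1^{i_1} ⋯ x_k^{i_k}`, whose coefficient singles out `M_I` among the monomial
quasi-symmetric functions of the same degree. -/
def leadingMonomial {n : ℕ} (I : Composition n) : ℕ+ →₀ ℕ :=
  ∑ k : Fin I.length, Finsupp.single (Nat.succPNat k) (I.blocksFun k)

theorem sum_single_apply {l : ℕ} {a : Fin l → ℕ+} (ha : Function.Injective a) (b : Fin l → ℕ)
    (j : Fin l) : (∑ k, Finsupp.single (a k) (b k)) (a j) = b j := by
  simp [Finsupp.finsetSum_apply, Finsupp.single_apply, ha.eq_iff]

theorem support_sum_single {l : ℕ} {a : Fin l → ℕ+} (ha : Function.Injective a) {b : Fin l → ℕ}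
    (hb : ∀ k, b k ≠ 0) : (∑ k, Finsupp.single (a k) (b k)).support = Finset.univ.image a := by
  ext c
  rw [Finsupp.mem_support_iff, Finset.mem_image]
  constructor
  · intro h
    by_contra! h'
    refine h ?_
    rw [Finsupp.finsetSum_apply]
    exact Finset.sum_eq_zero fun k hk => Finsupp.single_eq_of_ne (h' k hk).symm
  · rintro ⟨k, -, rfl⟩
    rw [sum_single_apply ha]
    exact hb k

/-- The exponents of a monomial, in the order of the variables, determine how it is written. -/
theorem sum_single_inj {l l' : ℕ} {a : Fin l → ℕ+} {a' : Fin l' → ℕ+} (ha : StrictMono a)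
    (ha' : StrictMono a') {b : Fin l → ℕ} {b' : Fin l' → ℕ} (hb : ∀ k, b k ≠ 0)
    (hb' : ∀ k, b' k ≠ 0)
    (h : ∑ k, Finsupp.single (a k) (b k) = ∑ k, Finsupp.single (a' k) (b' k)) :
    ∃ e : l = l', a = a' ∘ Fin.cast e ∧ b = b' ∘ Fin.cast e := by
  have hs := congrArg Finsupp.support h
  rw [support_sum_single ha.injective hb, support_sum_single ha'.injective hb'] at hs
  obtain rfl : l = l' := by
    have := congrArg Finset.card hs
    rwa [Finset.card_image_of_injective _ ha.injective,
      Finset.card_image_of_injective _ ha'.injective, Finset.card_univ, Finset.card_univ,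
      Fintype.card_fin, Fintype.card_fin] at this
  obtain rfl : a = a' := by
    refine (ha.range_inj ha').mp ?_
    simpa using congrArg (fun s : Finset ℕ+ => (s : Set ℕ+)) hs
  refine ⟨rfl, rfl, funext fun k => ?_⟩
  rw [← sum_single_apply ha.injective b k, h, sum_single_apply ha.injective]
  rfl

theorem M_leadingMonomial {n : ℕ} (I J : Composition n) :
    M I (leadingMonomial J) = if I = J then 1 else 0 := by
  have hmono : ∀ l, StrictMono fun k : Fin l => Nat.succPNat k := fun l k k' h => by simpa using h
  have hpos : ∀ (K : Composition n) k, K.blocksFun k ≠ 0 := fun K k => (K.blocks_pos' _ _).ne'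
  split_ifs with h
  · subst h
    have : {a : Fin I.length → ℕ+ | StrictMono a ∧
        ∑ k, Finsupp.single (a k) (I.blocksFun k) = leadingMonomial I} =
          {fun k : Fin I.length => Nat.succPNat k} := by
      ext a
      rw [Set.mem_ofPred_eq, Set.mem_singleton_iff]
      constructor
      · rintro ⟨ha, h⟩
        obtain ⟨e, ha', -⟩ := sum_single_inj ha (hmono _) (hpos I) (hpos I) h
        exact ha'
      · rintro rfl
        exact ⟨hmono _, rfl⟩
    exact congrArg Nat.cast (this ▸ Set.ncard_singleton _)
  · have : {a : Fin I.length → ℕ+ | StrictMono a ∧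
        ∑ k, Finsupp.single (a k) (I.blocksFun k) = leadingMonomial J} = ∅ := by
      refine Set.eq_empty_of_forall_notMem ?_
      rintro a ⟨ha, h'⟩
      obtain ⟨e, -, hb⟩ := sum_single_inj ha (hmono _) (hpos I) (hpos J) h'
      refine h (Composition.ext ?_)
      rw [← I.ofFn_blocksFun, ← J.ofFn_blocksFun, List.ofFn_congr e, hb]
      rfl
    exact congrArg Nat.cast (this ▸ Set.ncard_empty _)

theorem linearIndependent_M (n : ℕ) : LinearIndependent ℤ fun I : Composition n => M I :=
  linearIndependent_of_eval leadingMonomial M_leadingMonomial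

theorem linearIndependent_layeredF :
    LinearIndependent ℤ fun I : Σ n, Composition n => layeredF I.2 := by
  refine linearIndependent_of_graded_span Finsupp.degree
    (fun I : Σ n, Composition n => M I.2) _ (fun I m hm => ?_) linearIndependent_M
    (fun _ => M_mem_span_layeredF) fun _ => layeredF_mem_span_M
  by_contra h
  have hempty : {r | (ofComposition I.2).poset.OrderCondition r ∧ content r = m} = ∅ :=
    Set.eq_empty_of_forall_notMem fun r hr => h (hr.2 ▸ degree_content r)
  refine hm ?_
  rw [layeredF, ← RankedPoset.commImage_ncF, RankedPoset.ncF_eq, commImage_wordSeries_ind, hempty,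
    Set.ncard_empty, Nat.cast_zero]

end WordQSym

end

theorem mainTheorem3 :
    (∃ b : Module.Basis (Σ n, WordQSym.SetComposition n) ℤ WordQSym.WQSym,
      ∀ (n : ℕ) (K : WordQSym.SetComposition n),
        (b ⟨n, K⟩ : WordQSym.NCSeries) = K.poset.ncF) ∧
    (∃ c : Module.Basis (Σ n, Composition n) ℤ WordQSym.QSym,
      (∀ (n : ℕ) (I : Composition n),
        (c ⟨n, I⟩ : MvPowerSeries ℕ+ ℤ) = WordQSym.layeredF I) ∧
      (∀ (n : ℕ) (K : WordQSym.SetComposition n),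
        WordQSym.commImage K.poset.ncF = (c ⟨n, K.type⟩ : MvPowerSeries ℕ+ ℤ))) := by
  refine ⟨⟨(Module.Basis.span WordQSym.linearIndependent_ncF).map
      (LinearEquiv.ofEq _ _ WordQSym.span_ncF_eq), fun n K => ?_⟩,
    ⟨(Module.Basis.span WordQSym.linearIndependent_layeredF).map
      (LinearEquiv.ofEq _ _ WordQSym.span_layeredF_eq), fun n I => ?_, fun n K => ?_⟩⟩
  · simp [Module.Basis.span_apply]
  · simp [Module.Basis.span_apply]
  · simp [Module.Basis.span_apply, WordQSym.commImage_ncF]
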